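/- Let $\tilde\Omega\subset\Omega\subset\mathbb R^d$ with $\tilde\Omega$ nonempty and otherwise arbitrary, and let $k:\Omega\times\Omega\to\mathbb R$ be a strictly positive definite kernel (symmetric, with positive definite kernel matrix $(k(x_i,x_j))_{i,j}$ for all finite families of pairwise distinct points) such that $k(x,x)\le 1$ for all $x\in\Omega$. Let $\tilde k=k|_{\tilde\Omega\times\tilde\Omega}$, and let $\mathcal H_k(\Omega)$, $\mathcal H_{\tilde k}(\tilde\Omega)$ be the reproducing kernel Hilbert spaces of $k$ and $\tilde k$. For a finite set $X\subset\Omega$ put $V(X)=\operatorname{span}\{k(\cdot,x):x\in X\}$, let $\Pi_{V(X)}$ be the orthogonal projection of $\mathcal H_k(\Omega)$ onto $V(X)$, and define the power function $P_X(x)=\|k(\cdot,x)-\Pi_{V(X)}k(\cdot,x)\|_{\mathcal H_k(\Omega)}$; define $\tilde V(X)$, $\Pi_{\tilde V(X)}$ and $\tilde P_X$ in the same way for $\tilde k$ on $\tilde\Omega$. Here $\|g\|_{L^\infty(\Omega)}=\sup_{x\in\Omega}|g(x)|$, and likewise on $\tilde\Omega$. For $0<\gamma\le 1$, a $\gamma$-weak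 $P$-greedy sequence on $\tilde\Omega$ is a sequence of finite sets $\tilde X_n\subset\tilde\Omega$ with $\tilde X_0=\emptyset$ and $\tilde X_{n+1}=\tilde X_n\cup\{x_{n+1}\}$, where $x_{n+1}\in\tilde\Omega$ satisfies $\tilde P_{\tilde X_n}(x_{n+1})\ge\gamma\,\tilde P_{\tilde X_n}(y)$ for all $y\in\tilde\Omega$. A $P$-greedy sequence is the case $\gamma=1$, i.e. $x_{n+1}$ is a maximizer of $\tilde P_{\tilde X_n}$ over $\tilde\Omega$. Let $\alpha>0$ and let $X_n\subset\Omega$, $n\in\mathbb N$, be (not necessarily nested) sets of at most $n$ points. 1. (Algebraic decay) Suppose that, for some constant $C_0$, $$\|f-\Pi_{V(X_n)}f\|_{L^\infty(\Omega)}\le C_0\,n^{-\alpha}\|f\|_{\mathcal H_k(\Omega)}\qquad\text{for all } f\in\mathcal H_k(\Omega),\ n\ge 1.$$ Then every $P$-greedy sequence $(\tilde X_n)$ on $\tilde\Omega$ satisfies $$\|f-\Pi_{\tilde V(\tilde X_n)}f\|_{L^\infty(\tilde\Omega)}\le \tilde C_0\,n^{-\alpha}\|f\|_{\mathcal H_{\tilde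 k}(\tilde\Omega)}\qquad\text{for all } f\in\mathcal H_{\tilde k}(\tilde\Omega),\ n\ge1,$$ with $\tilde C_0=2^{5\alpha+1}C_0$. Moreover, whether or not the maxima in the $P$-greedy algorithm are attained, for every $0<\gamma<1$ there is a $\gamma$-weak $P$-greedy sequence on $\tilde\Omega$ satisfying the same bound with the same constant. 2. (Exponential decay) Suppose that, for some constants $C_1$ and $C_2>0$, $$\|f-\Pi_{V(X_n)}f\|_{L^\infty(\Omega)}\le C_1e^{-C_2n^{\alpha}}\|f\|_{\mathcal H_k(\Omega)}\qquad\text{for all } f\in\mathcal H_k(\Omega),\ n\ge 1.$$ Then every $P$-greedy sequence $(\tilde X_n)$ on $\tilde\Omega$ satisfies $$\|f-\Pi_{\tilde V(\tilde X_n)}f\|_{L^\infty(\tilde\Omega)}\le \sqrt{2C_1}\,e^{-\tilde C_2n^{\alpha}}\|f\|_{\mathcal H_{\tilde k}(\tilde\Omega)}\qquad\text{for all } f\in\mathcal H_{\tilde k}(\tilde\Omega),\ n\ge1,$$ with $\tilde C_2=2^{-1-2\alpha}C_2<C_2$. Moreover, whether or not the maxima are attained, for every $0<\gamma<1$ there is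 a $\gamma$-weak $P$-greedy sequence on $\tilde\Omega$ satisfying the same bound with the same constants. In both cases the sets $\tilde X_n$ are nested and $\tilde X_n$ has exactly $\min(n,|\tilde\Omega|)$ points (so $n$ pairwise distinct points if $\tilde\Omega$ is infinite). -/

import Mathlib

open scoped ENNReal

noncomputable section

/-- A kernel `k : S × S → ℝ` is strictly positive definite: every kernel matrix on finitely many
pairwise distinct points is (symmetric) positive definite. Two-point matrices give the symmetry
of `k`. -/
def IsStrictlyPosDefKernel {S : Type*} (k : S → S → ℝ) : Prop :=
  ∀ s : Finset S, (Matrix.of fun i j : s => k i j).PosDef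

/-- The restriction of a kernel on `Ω` to a subset `Ω'`. -/
def restrictKernel {E : Type*} {Ω' Ω : Set E} (h : Ω' ⊆ Ω) (k : Ω → Ω → ℝ) : Ω' → Ω' → ℝ :=
  fun x y => k (Set.inclusion h x) (Set.inclusion h y)

/-- The sup norm of a function, over all points of its domain, with values in `[0, ∞]`. -/
def supNorm {S : Type*} (g : S → ℝ) : ℝ≥0∞ := ⨆ x, ‖g x‖ₑ

section Interpolation

variable {S : Type*} (H : Type*) [NormedAddCommGroup H] [InnerProductSpace ℝ H] [CompleteSpace H]
  [RKHS ℝ H S ℝ]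

/-- `H` is the reproducing kernel Hilbert space `H_k(S)`: a Hilbert space of functions on `S`
that contains every `k(·, x)` and satisfies `f x = ⟪f, k(·, x)⟫` for all `f` and `x`.
Such a space is determined by `k` up to a unique isometry that preserves point values. -/
def IsRKHSOf (k : S → S → ℝ) : Prop :=
  ∀ x : S, ∃ g : H, (∀ y, g y = k y x) ∧ ∀ f : H, f x = inner ℝ f g

/-- The element `k(·, x)` of the space, where `k` is its reproducing kernel: it is the Riesz
representer of point evaluation at `x`. -/
def kernelSection (x : S) : H := RKHS.kerFun H x (1 : ℝ)

/-- `V(X)`, the span of the `k(·, x)` with `x ∈ X`. -/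
def kernelSpan (X : Finset S) : Submodule ℝ H :=
  Submodule.span ℝ (kernelSection H '' (X : Set S))

instance finiteDimensional_kernelSpan (X : Finset S) : FiniteDimensional ℝ (kernelSpan H X) :=
  FiniteDimensional.span_of_finite ℝ (X.finite_toSet.image _)

variable {H} in
/-- The kernel interpolant of `f`: its orthogonal projection onto `V(X)`. -/
def interpolant (X : Finset S) (f : H) : H := (kernelSpan H X).starProjection f

/-- The power function `P_X(x) = ‖k(·, x) - Π_{V(X)} k(·, x)‖`, which is the largest
value at `x` of `|f - Π_{V(X)} f|` over the unit ball of `H`. -/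
def powerFunction (X : Finset S) (x : S) : ℝ :=
  ‖kernelSection H x - interpolant X (kernelSection H x)‖

/-- `X 0 = ∅` and `X (n + 1) = X n ∪ {x}`, where `x` satisfies `P_{X n}(x) ≥ γ sup P_{X n}`. -/
def IsWeakPGreedy (γ : ℝ) (X : ℕ → Finset S) : Prop :=
  X 0 = ∅ ∧ ∀ n, ∃ x : S, (∀ y, γ * powerFunction H (X n) y ≤ powerFunction H (X n) x) ∧
    (X (n + 1) : Set S) = insert x (X n : Set S)

/-- `X 0 = ∅` and `X (n + 1) = X n ∪ {x}`, where `x` is a maximizer of `P_{X n}`. -/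
def IsPGreedy (X : ℕ → Finset S) : Prop :=
  X 0 = ∅ ∧ ∀ n, ∃ x : S, (∀ y, powerFunction H (X n) y ≤ powerFunction H (X n) x) ∧
    (X (n + 1) : Set S) = insert x (X n : Set S)

/-- `‖f - Π_{V(X n)} f‖_∞ ≤ r n * ‖f‖` for all `f` in the space and all `n ≥ 1`. -/
def HasInterpolationRate (X : ℕ → Finset S) (r : ℕ → ℝ) : Prop :=
  ∀ n : ℕ, 1 ≤ n → ∀ f : H,
    supNorm (fun x => f x - interpolant (X n) f x) ≤ ENNReal.ofReal (r n * ‖f‖)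

end Interpolation

/-- A nested sequence of point sets; the `n`-th one has `n` pairwise distinct points, or
all points of `S` if there are fewer than `n` of them. -/
def IsNestedPointSequence {S : Type*} (X : ℕ → Finset S) : Prop :=
  Monotone X ∧ ∀ n : ℕ, ((X n).card : ℕ∞) = min (n : ℕ∞) (ENat.card S)

end

/-! By Cauchy–Schwarz, with equality for a suitable `f`, a rate in the sup norm is a bound on the
power function (`hasInterpolationRate_iff`). The hypothesis thus says that `V(X n)`, of dimension at
most `n`, is close to every `k(·, x)`: a bound on the Kolmogorov widths of these vectors. Widths
allow any subspace of `H`, so `X n` need not lie in `Ω'`. The sections over `Ω'` have the same Gram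
matrix in `H` as in `H'`, so the greedy selection on `Ω'` can be studied inside `H`
(`powerFunction_restrict`).

It remains to compare greedy errors `σ` with widths `d` in a Hilbert space. Orthonormalising the
selected vectors turns `2m` consecutive ones into a triangular matrix with the errors on the
diagonal. Its determinant is small because the vectors are near an `m`-dimensional subspace
(`prod_norm_sub_starProjection_le`). As the errors decrease, `σ_n² ≤ 2 σ_N d_m` for `N + 2m ≤ n + 1`
(`sq_norm_sub_le`). Taking `N = 2m` and inducting gives the algebraic rate; `N = 0` gives the
exponential one, where the square root halves the exponent.

Both estimates have slack. Weak factors below `1` whose products all stay near `1` cost no more than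
this slack, so the constants survive when maxima are not attained. -/

/-! ### Determinant bounds. -/

/-- The inequality between arithmetic and geometric means, as a bound on a product. -/
lemma prod_le_pow_of_sum_le {ι : Type*} (s : Finset ι) (z : ι → ℝ) (c : ℝ)
    (hz : ∀ i ∈ s, 0 ≤ z i) (h : ∑ i ∈ s, z i ≤ s.card * c) : ∏ i ∈ s, z i ≤ c ^ s.card := by
  rcases s.eq_empty_or_nonempty with rfl | hs
  · simp
  have hc : (0 : ℝ) < s.card := by exact_mod_cast hs.card_pos
  have hw : ∑ _i ∈ s, ((s.card : ℝ)⁻¹) = 1 := by simp [hc.ne']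
  have h1 := Real.geom_mean_le_arith_mean_weighted s (fun _ => (s.card : ℝ)⁻¹) z
    (fun _ _ => by positivity) hw hz
  rw [← Finset.mul_sum] at h1
  have h2 : ∏ i ∈ s, z i ^ ((s.card : ℝ)⁻¹) ≤ c := by
    refine h1.trans ?_
    rw [inv_mul_le_iff₀ hc]
    exact h
  calc ∏ i ∈ s, z i = (∏ i ∈ s, z i ^ ((s.card : ℝ)⁻¹)) ^ s.card := by
        rw [← Finset.prod_pow]
        refine Finset.prod_congr rfl fun i hi => ?_
        rw [Real.rpow_inv_natCast_pow (hz i hi) hs.card_pos.ne']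
    _ ≤ c ^ s.card := by
        refine pow_le_pow_left₀ (Finset.prod_nonneg fun i hi => Real.rpow_nonneg (hz i hi) _) h2 _

/-- Hadamard's inequality for real matrices. -/
lemma sq_det_le_prod_sum_sq {n : ℕ} (M : Matrix (Fin n) (Fin n) ℝ) :
    M.det ^ 2 ≤ ∏ i, ∑ j, M i j ^ 2 := by
  have : Fact (Module.finrank ℝ (EuclideanSpace ℝ (Fin n)) = n) := ⟨by simp⟩
  set e := EuclideanSpace.basisFun (Fin n) ℝ
  have h := e.toBasis.orientation.abs_volumeForm_apply_le (fun i => WithLp.toLp 2 (M i))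
  rw [e.toBasis.orientation.volumeForm_robust'  e, Module.Basis.det_apply] at h
  have hM : e.toBasis.toMatrix (fun i => WithLp.toLp 2 (M i)) = M.transpose := by
    ext i j
    simp [e, Module.Basis.toMatrix_apply]
  rw [hM, Matrix.det_transpose] at h
  rw [← sq_abs]
  refine (pow_le_pow_left₀ (abs_nonneg _) h 2).trans_eq ?_
  rw [← Finset.prod_pow]
  refine Finset.prod_congr rfl fun i _ => ?_
  rw [EuclideanSpace.norm_sq_eq]
  simp

/-- The determinant of `2 * m` vectors of length at most `s` that lie within distance `d` of an
`m`-dimensional subspace. -/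
lemma abs_det_le_of_near_subspace {m : ℕ} (r u : Fin (2 * m) → EuclideanSpace ℝ (Fin (2 * m)))
    {s d : ℝ} (hs : 0 ≤ s) (hd : 0 ≤ d) (hr : ∀ i, ‖r i‖ ≤ s)
    (U : Submodule ℝ (EuclideanSpace ℝ (Fin (2 * m)))) (hU : Module.finrank ℝ U ≤ m)
    (hu : ∀ i, u i ∈ U) (hru : ∀ i, ‖r i - u i‖ ≤ d) :
    |(Matrix.of fun i j => r i j).det| ≤ (2 * s * d) ^ m := by
  have : Fact (Module.finrank ℝ (EuclideanSpace ℝ (Fin (2 * m))) = 2 * m) := ⟨by simp⟩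
  have hfin : m ≤ Module.finrank ℝ Uᗮ := by
    have h := U.finrank_add_finrank_orthogonal
    rw [show Module.finrank ℝ (EuclideanSpace ℝ (Fin (2 * m))) = 2 * m by simp] at h
    omega
  -- `m` orthonormal vectors of `Uᗮ` become the last `m` members of an orthonormal basis `b`.
  let q := stdOrthonormalBasis ℝ Uᗮ
  let v : Fin (2 * m) → EuclideanSpace ℝ (Fin (2 * m)) := fun j =>
    if h : m ≤ j then (q ⟨j - m, by have := j.2; omega⟩ : EuclideanSpace ℝ (Fin (2 * m))) else 0
  let S : Set (Fin (2 * m)) := {j | m ≤ (j : ℕ)}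
  have hv : Orthonormal ℝ (S.domRestrict v) := by
    have hq : Orthonormal ℝ (fun j => (q j : EuclideanSpace ℝ (Fin (2 * m)))) :=
      q.orthonormal.comp_linearIsometry Uᗮ.subtypeₗᵢ
    have := hq.comp (fun j : S => (⟨j.1 - m, by have := j.1.2; omega⟩ : Fin _)) (by
      intro a b hab
      have ha := a.2
      have hb := b.2
      simp only [S, Set.mem_ofPred_eq] at ha hb
      simp only [Fin.mk.injEq] at hab
      exact Subtype.ext (Fin.ext (by omega)))
    convert this using 1
    ext1 j
    have hj : m ≤ (j.1 : ℕ) := j.2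
    simp [v, hj]
  obtain ⟨b, hb⟩ := hv.exists_orthonormalBasis_extension_of_card_eq (𝕜 := ℝ) (by simp)
  have hbU : ∀ j : Fin (2 * m), m ≤ (j : ℕ) → b j ∈ Uᗮ := by
    intro j hj
    rw [hb j hj]
    simp only [v, dif_pos hj]
    exact Submodule.coe_mem _
  set e := EuclideanSpace.basisFun (Fin (2 * m)) ℝ
  -- The change of basis costs only a sign. The rows are now the coordinates along `b`, so that
  -- Hadamard's inequality can exploit the `m` small rows, those along `Uᗮ`.
  have hdet : |(Matrix.of fun i j => r i j).det| =
      |(Matrix.of fun j i => inner ℝ (b j) (r i)).det| := by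
    have h1 := e.toBasis.orientation.volumeForm_robust' e r
    have h2 := e.toBasis.orientation.volumeForm_robust' b r
    rw [h1, Module.Basis.det_apply, Module.Basis.det_apply] at h2
    rw [← Matrix.det_transpose]
    convert h2 using 3
    · ext i j
      simp [e, Module.Basis.toMatrix_apply]
    · ext i j
      simp [Module.Basis.toMatrix_apply, b.repr_apply_apply]
  rw [hdet]
  have hpars : ∀ i, ∑ j, inner ℝ (b j) (r i) ^ 2 ≤ s ^ 2 := fun i => by
    have := b.sum_sq_norm_inner_right (r i)
    simp only [Real.norm_eq_abs, sq_abs] at this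
    rw [this]
    exact pow_le_pow_left₀ (norm_nonneg _) (hr i) 2
  set A : Finset (Fin (2 * m)) := Finset.univ.filter fun j => m ≤ (j : ℕ)
  have hA : A.card = m := by
    let f : Fin m → Fin (2 * m) := fun j => ⟨m + j, by have := j.2; omega⟩
    have hf : f.Injective := fun a b h => Fin.ext (by simpa [f] using congrArg Fin.val h)
    have : A = Finset.univ.image f := by
      ext j
      simp only [A, Finset.mem_filter, Finset.mem_univ, true_and, Finset.mem_image]
      constructor
      · intro h
        exact ⟨⟨j - m, by have := j.2; omega⟩, Fin.ext (Nat.add_sub_cancel' h)⟩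
      · rintro ⟨a, rfl⟩
        exact Nat.le_add_right _ _
    rw [this, Finset.card_image_of_injective _ hf, Finset.card_univ, Fintype.card_fin]
  have hAc : Aᶜ.card = m := by
    rw [Finset.card_compl, hA, Fintype.card_fin]; omega
  have hd2 : ∀ i, ∑ j ∈ A, inner ℝ (b j) (r i) ^ 2 ≤ d ^ 2 := fun i => by
    calc ∑ j ∈ A, inner ℝ (b j) (r i) ^ 2 = ∑ j ∈ A, inner ℝ (b j) (r i - u i) ^ 2 := by
          refine Finset.sum_congr rfl fun j hj => ?_
          rw [inner_sub_right, Submodule.inner_left_of_mem_orthogonal (hu i)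
            (hbU j (Finset.mem_filter.1 hj).2), sub_zero]
      _ ≤ ∑ j, inner ℝ (b j) (r i - u i) ^ 2 :=
          Finset.sum_le_sum_of_subset_of_nonneg (Finset.subset_univ _) fun _ _ _ => sq_nonneg _
      _ = ‖r i - u i‖ ^ 2 := by
          have := b.sum_sq_norm_inner_right (r i - u i)
          simpa only [Real.norm_eq_abs, sq_abs] using this
      _ ≤ d ^ 2 := pow_le_pow_left₀ (norm_nonneg _) (hru i) 2
  have hprodA : ∏ j ∈ A, ∑ i, inner ℝ (b j) (r i) ^ 2 ≤ (2 * d ^ 2) ^ m := by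
    have := prod_le_pow_of_sum_le A (fun j => ∑ i, inner ℝ (b j) (r i) ^ 2) (2 * d ^ 2)
      (fun _ _ => Finset.sum_nonneg fun _ _ => sq_nonneg _) (by
        rw [Finset.sum_comm]
        refine (Finset.sum_le_sum fun i _ => hd2 i).trans_eq ?_
        simp [hA]; ring)
    rwa [hA] at this
  have hprodAc : ∏ j ∈ Aᶜ, ∑ i, inner ℝ (b j) (r i) ^ 2 ≤ (2 * s ^ 2) ^ m := by
    have := prod_le_pow_of_sum_le Aᶜ (fun j => ∑ i, inner ℝ (b j) (r i) ^ 2) (2 * s ^ 2)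
      (fun _ _ => Finset.sum_nonneg fun _ _ => sq_nonneg _) (by
        rw [Finset.sum_comm]
        refine (Finset.sum_le_sum fun i _ => (Finset.sum_le_sum_of_subset_of_nonneg
          (Finset.subset_univ _) fun _ _ _ => sq_nonneg _).trans (hpars i)).trans_eq ?_
        simp [hAc]; ring)
    rwa [hAc] at this
  refine abs_le_of_sq_le_sq ?_ (by positivity)
  refine (sq_det_le_prod_sum_sq _).trans ?_
  rw [← Finset.prod_mul_prod_compl A]
  refine (mul_le_mul hprodA hprodAc (Finset.prod_nonneg fun _ _ => Finset.sum_nonneg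
    fun _ _ => sq_nonneg _) (by positivity)).trans_eq ?_
  rw [← mul_pow, ← pow_mul, mul_comm m 2, pow_mul]
  congr 1
  ring

/-! ### Products of successive distances in a Hilbert space. -/

section Hilbert

variable {E : Type*} [NormedAddCommGroup E] [InnerProductSpace ℝ E]

/-- For vectors `v i` and an increasing sequence of subspaces `V i` with `v i ∈ V (i + 1)`, the
product of the distances of `v i` to `V i`, over `2 * m` consecutive indices from `N` on, is
controlled by the distances of the `v i` to `V N` and to an `m`-dimensional subspace. -/
lemma prod_norm_sub_starProjection_le (V : ℕ → Submodule ℝ E) [∀ n, FiniteDimensional ℝ (V n)]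
    (hV : Monotone V) (v : ℕ → E) (hv : ∀ n, v n ∈ V (n + 1)) (N m : ℕ) {s d : ℝ}
    (hs : 0 ≤ s) (hd : 0 ≤ d) (hvs : ∀ n, ‖v n - (V N).starProjection (v n)‖ ≤ s)
    (W : Submodule ℝ E) [FiniteDimensional ℝ W] (hW : Module.finrank ℝ W ≤ m)
    (hvd : ∀ n, ‖v n - W.starProjection (v n)‖ ≤ d) :
    ∏ i ∈ Finset.range (2 * m), ‖v (N + i) - (V (N + i)).starProjection (v (N + i))‖
      ≤ (2 * s * d) ^ m := by
  set a : ℕ → ℝ := fun n => ‖v n - (V n).starProjection (v n)‖ with ha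
  by_cases h0 : ∃ i ∈ Finset.range (2 * m), a (N + i) = 0
  · obtain ⟨i, hi, h⟩ := h0
    rw [Finset.prod_eq_zero hi h]
    positivity
  push Not at h0
  have hapos : ∀ i : Fin (2 * m), a (N + i) ≠ 0 := fun i => h0 i (Finset.mem_range.2 i.2)
  let e : Fin (2 * m) → E := fun j =>
    (a (N + j))⁻¹ • (v (N + j) - (V (N + j)).starProjection (v (N + j)))
  have heV : ∀ j : Fin (2 * m), e j ∈ (V (N + j))ᗮ := fun j =>
    Submodule.smul_mem _ _ (Submodule.sub_starProjection_mem_orthogonal _)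
  have heV' : ∀ j : Fin (2 * m), e j ∈ V (N + j + 1) := fun j =>
    Submodule.smul_mem _ _ (Submodule.sub_mem _ (hv _)
      (hV (Nat.le_succ _) (Submodule.starProjection_apply_mem _ _)))
  have horth : ∀ i j : Fin (2 * m), i < j → ∀ x ∈ V (N + i + 1), inner ℝ (e j) x = 0 :=
    fun i j hij x hx => Submodule.inner_left_of_mem_orthogonal
      (hV (by have : (i : ℕ) < j := hij; omega) hx) (heV j)
  have heo : Orthonormal ℝ e := by
    refine ⟨fun j => ?_, fun i j hij => ?_⟩
    · simp only [e, norm_smul, norm_inv, Real.norm_eq_abs]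
      change |a (N + j)|⁻¹ * a (N + j) = 1
      rw [abs_of_nonneg (norm_nonneg _)]
      exact inv_mul_cancel₀ (hapos j)
    · rcases lt_or_gt_of_ne hij with h | h
      · rw [real_inner_comm]
        exact horth i j h _ (heV' i)
      · exact horth j i h _ (heV' j)
  -- Coordinates along the `e j`: a contraction that kills `V N`, whence the radius `s`, and maps
  -- `W` to dimension at most `m`.
  let Q : E →ₗ[ℝ] EuclideanSpace ℝ (Fin (2 * m)) :=
    (WithLp.linearEquiv 2 ℝ (Fin (2 * m) → ℝ)).symm.toLinearMap ∘ₗ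
      LinearMap.pi fun j => (innerSL ℝ (e j)).toLinearMap
  have hQ : ∀ x j, Q x j = inner ℝ (e j) x := fun x j => by simp [Q]
  have hQn : ∀ x, ‖Q x‖ ≤ ‖x‖ := fun x => by
    have h := heo.sum_inner_products_le x (s := Finset.univ)
    refine (sq_le_sq₀ (norm_nonneg _) (norm_nonneg _)).1 ?_
    rw [EuclideanSpace.norm_sq_eq]
    simpa only [hQ] using h
  have hQs : ∀ i : Fin (2 * m), ‖Q (v (N + i))‖ ≤ s := fun i => by
    have h0 : Q ((V N).starProjection (v (N + i))) = 0 := by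
      ext j
      rw [hQ]
      exact Submodule.inner_left_of_mem_orthogonal
        (hV (Nat.le_add_right N j) (Submodule.starProjection_apply_mem _ _)) (heV j)
    have := hQn (v (N + i) - (V N).starProjection (v (N + i)))
    rw [map_sub, h0, sub_zero] at this
    exact this.trans (hvs _)
  have key := abs_det_le_of_near_subspace (fun i : Fin (2 * m) => Q (v (N + i)))
    (fun i => Q (W.starProjection (v (N + i)))) hs hd hQs (W.map Q)
    ((Submodule.finrank_map_le Q W).trans hW)
    (fun i => Submodule.mem_map_of_mem (Submodule.starProjection_apply_mem _ _))
    (fun i => by rw [← map_sub]; exact (hQn _).trans (hvd _))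
  rw [Matrix.det_of_isLowerTriangular] at key
  · have hdiag : ∀ i : Fin (2 * m), Q (v (N + i)) i = a (N + i) := fun i => by
      rw [hQ]
      have h1 : inner ℝ (e i) ((V (N + i)).starProjection (v (N + i))) = 0 :=
        Submodule.inner_left_of_mem_orthogonal (Submodule.starProjection_apply_mem _ _) (heV i)
      rw [← sub_zero (inner ℝ (e i) (v (N + i))), ← h1, ← inner_sub_right]
      simp only [e, real_inner_smul_left, real_inner_self_eq_norm_sq]
      change (a (N + i))⁻¹ * a (N + i) ^ 2 = a (N + i)
      field_simp [hapos i]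
    simp only [Matrix.of_apply, hdiag] at key
    rw [Finset.prod_range]
    exact (le_abs_self _).trans key
  · intro i j hij
    rw [Matrix.of_apply, hQ]
    exact horth i j hij _ (hv _)

end Hilbert

/-! ### Greedy errors against widths. -/

section Greedy

variable {E : Type*} [NormedAddCommGroup E] [InnerProductSpace ℝ E]

lemma norm_sub_starProjection_le_norm_sub (U : Submodule ℝ E) [U.HasOrthogonalProjection] (z : E)
    {u : E} (hu : u ∈ U) : ‖z - U.starProjection z‖ ≤ ‖z - u‖ := by
  rw [U.starProjection_minimal]
  exact ciInf_le (f := fun x : U => ‖z - x‖) ⟨0, by rintro _ ⟨x, rfl⟩; positivity⟩ ⟨u, hu⟩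

lemma norm_sub_starProjection_anti {U U' : Submodule ℝ E} [U.HasOrthogonalProjection]
    [U'.HasOrthogonalProjection] (h : U ≤ U') (z : E) :
    ‖z - U'.starProjection z‖ ≤ ‖z - U.starProjection z‖ :=
  norm_sub_starProjection_le_norm_sub U' z (h (Submodule.starProjection_apply_mem _ _))

/-- The subspaces `V n` come from a greedy selection among the vectors `w y`: the selected vector
`w (x n)` lies in `V (n + 1)`, and its distance to `V n` is largest up to the factor `g n`.
The products of the factors stay above `G`. -/
structure IsGreedyChain {S : Type*} (w : S → E) (V : ℕ → Submodule ℝ E)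
    [∀ n, FiniteDimensional ℝ (V n)] (x : ℕ → S) (g : ℕ → ℝ) (G : ℝ) : Prop where
  mono : Monotone V
  mem : ∀ n, w (x n) ∈ V (n + 1)
  nonneg : ∀ n, 0 ≤ g n
  le_one : ∀ n, g n ≤ 1
  greedy : ∀ n y, g n * ‖w y - (V n).starProjection (w y)‖ ≤
    ‖w (x n) - (V n).starProjection (w (x n))‖
  pos : 0 < G
  prod_ge : ∀ n, G ≤ ∏ i ∈ Finset.range n, g i

/-- Some subspace of dimension at most `m` has distance at most `d` to every `w y`. -/
def HasWidthLE {S : Type*} (w : S → E) (m : ℕ) (d : ℝ) : Prop :=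
  ∃ W : Submodule ℝ E, ∃ _ : FiniteDimensional ℝ W, Module.finrank ℝ W ≤ m ∧
    ∀ y, ‖w y - W.starProjection (w y)‖ ≤ d

namespace IsGreedyChain

variable {S : Type*} {w : S → E} {V : ℕ → Submodule ℝ E} [∀ n, FiniteDimensional ℝ (V n)]
  {x : ℕ → S} {g : ℕ → ℝ} {G : ℝ}

lemma norm_sub_anti (h : IsGreedyChain w V x g G) {n n' : ℕ} (hn : n ≤ n') (y : S) :
    ‖w y - (V n').starProjection (w y)‖ ≤ ‖w y - (V n).starProjection (w y)‖ :=
  norm_sub_starProjection_anti (h.mono hn) _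

lemma G_le_one (h : IsGreedyChain w V x g G) : G ≤ 1 := by simpa using h.prod_ge 0

lemma le_prod_shift (h : IsGreedyChain w V x g G) (N n : ℕ) :
    G ≤ ∏ i ∈ Finset.range n, g (N + i) := by
  refine (h.prod_ge (N + n)).trans ?_
  rw [Finset.prod_range_add]
  exact mul_le_of_le_one_left (Finset.prod_nonneg fun _ _ => h.nonneg _)
    (Finset.prod_le_one (fun _ _ => h.nonneg _) fun _ _ => h.le_one _)

/-- The indices `N, ..., N + 2m - 1` are all at most `n`, so each error in the product is at least
its factor times the error at `n`. The factors enter through their product only; the root `G^(1/m)`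
is then weakened to `G`. -/
lemma sq_norm_sub_le (h : IsGreedyChain w V x g G) {N m : ℕ} (hm : 1 ≤ m) {s d : ℝ}
    (hs : ∀ y, ‖w y - (V N).starProjection (w y)‖ ≤ s) (hd : HasWidthLE w m d) {n : ℕ}
    (hn : N + 2 * m ≤ n + 1) (y : S) :
    ‖w y - (V n).starProjection (w y)‖ ^ 2 ≤ 2 * s * d / G := by
  obtain ⟨W, _, hW, hd⟩ := hd
  have hs0 : 0 ≤ s := (norm_nonneg _).trans (hs y)
  have hd0 : 0 ≤ d := (norm_nonneg _).trans (hd y)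
  have h1 := prod_norm_sub_starProjection_le V h.mono (fun n => w (x n)) h.mem N m hs0 hd0
    (fun n => hs _) W hW (fun n => hd _)
  set t := ‖w y - (V n).starProjection (w y)‖ with ht
  have ht0 : 0 ≤ t := norm_nonneg _
  have h2 : G * t ^ (2 * m) ≤ (2 * s * d) ^ m := by
    refine le_trans ?_ h1
    calc G * t ^ (2 * m) ≤ (∏ i ∈ Finset.range (2 * m), g (N + i)) * t ^ (2 * m) :=
          mul_le_mul_of_nonneg_right (h.le_prod_shift N _) (by positivity)
      _ = ∏ i ∈ Finset.range (2 * m), g (N + i) * t := by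
          rw [Finset.prod_mul_distrib, Finset.prod_const, Finset.card_range]
      _ ≤ _ := by
          refine Finset.prod_le_prod (fun i _ => mul_nonneg (h.nonneg _) ht0) fun i hi => ?_
          rw [Finset.mem_range] at hi
          exact (mul_le_mul_of_nonneg_left (h.norm_sub_anti (by omega) y) (h.nonneg _)).trans
            (h.greedy _ y)
  have hG := h.pos
  refine le_of_pow_le_pow_left₀ (n := m) (by omega) (by positivity) ?_
  rw [← pow_mul, div_pow]
  rw [le_div_iff₀ (by positivity)]
  have h3 : G ^ m ≤ G := pow_le_of_le_one hG.le h.G_le_one (by omega)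
  calc t ^ (2 * m) * G ^ m ≤ t ^ (2 * m) * G := by gcongr
    _ ≤ _ := by rw [mul_comm]; exact h2

/-- Starts the induction for the algebraic rate: with `N = 0`, `m = 1` the first error occurs on
both sides and cancels, leaving a bound linear in `d`. -/
lemma norm_sub_le_of_hasWidthLE_one (h : IsGreedyChain w V x g G) {d : ℝ}
    (hd : HasWidthLE w 1 d) {n : ℕ} (hn : 1 ≤ n) (y : S) :
    ‖w y - (V n).starProjection (w y)‖ ≤ 2 * d / G := by
  obtain ⟨W, _, hW, hd⟩ := hd
  have hd0 : 0 ≤ d := (norm_nonneg _).trans (hd y)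
  have hG := h.pos
  have hg0 : 0 < g 0 := hG.trans_le (by simpa using h.prod_ge 1)
  refine (h.norm_sub_anti hn y).trans ?_
  set a := ‖w (x 0) - (V 0).starProjection (w (x 0))‖ with ha
  have hs : ∀ z, ‖w z - (V 0).starProjection (w z)‖ ≤ a / g 0 := fun z => by
    rw [le_div_iff₀ hg0, mul_comm]
    exact h.greedy 0 z
  have ha0 : 0 ≤ a := norm_nonneg _
  rcases ha0.eq_or_lt with h0 | h0
  · have := (h.norm_sub_anti zero_le_one y).trans (hs y)
    rw [← h0, zero_div] at this
    exact this.trans (by positivity)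
  have h1 := prod_norm_sub_starProjection_le V h.mono (fun n => w (x n)) h.mem 0 1 (s := a / g 0)
    (by positivity) hd0 (fun n => hs _) W hW (fun n => hd _)
  simp only [Finset.prod_range_succ, Finset.prod_range_zero, one_mul, zero_add, pow_one,
    mul_one] at h1
  have h2 : ‖w (x 1) - (V 1).starProjection (w (x 1))‖ ≤ 2 * d / g 0 := by
    refine le_of_mul_le_mul_left (h1.trans_eq ?_) h0
    ring
  have h3 := (h.greedy 1 y).trans h2
  have h4 : G ≤ g 0 * g 1 := by simpa [Finset.prod_range_succ] using h.prod_ge 2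
  rw [le_div_iff₀ hg0] at h3
  rw [le_div_iff₀ hG]
  calc _ ≤ ‖w y - (V 1).starProjection (w y)‖ * (g 0 * g 1) := by gcongr
    _ ≤ _ := by linarith

/-- A greedy selection inherits an algebraic decay of the widths. -/
theorem algebraic_rate (h : IsGreedyChain w V x g G) {α C : ℝ} (hα : 0 < α) (hC : 0 ≤ C)
    (hG : G⁻¹ ≤ (16 / 9 : ℝ) ^ α) (hd : ∀ m : ℕ, 1 ≤ m → HasWidthLE w m (C * (m : ℝ) ^ (-α)))
    (n : ℕ) (hn : 1 ≤ n) (y : S) :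
    ‖w y - (V n).starProjection (w y)‖ ≤ (2 : ℝ) ^ (5 * α + 1) * C * (n : ℝ) ^ (-α) := by
  have h32 : (2 : ℝ) ^ (5 * α + 1) = 2 * 32 ^ α := by
    rw [Real.rpow_add two_pos, Real.rpow_mul two_pos.le, Real.rpow_one, mul_comm]
    norm_num
  have hGp := h.pos
  rw [h32]
  induction n using Nat.strong_induction_on generalizing y with
  | _ n ih =>
  have hn0 : (0 : ℝ) < n := by exact_mod_cast hn
  -- For `n < 3` no `m ≥ 1` satisfies `4 * m ≤ n + 1`.
  by_cases hn3 : n < 3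
  · refine (h.norm_sub_le_of_hasWidthLE_one (hd 1 le_rfl) hn y).trans ?_
    rw [Nat.cast_one, Real.one_rpow, mul_one, div_eq_mul_inv]
    have h1 : (16 / 9 : ℝ) ^ α ≤ 32 ^ α * (n : ℝ) ^ (-α) := by
      rw [Real.rpow_neg hn0.le, ← div_eq_mul_inv, ← Real.div_rpow (by norm_num) hn0.le]
      refine Real.rpow_le_rpow (by norm_num) ?_ hα.le
      have : (n : ℝ) ≤ 2 := by exact_mod_cast (by omega : n ≤ 2)
      rw [le_div_iff₀ hn0]
      linarith
    calc 2 * C * G⁻¹ ≤ 2 * C * (32 ^ α * (n : ℝ) ^ (-α)) := by gcongr; exact hG.trans h1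
      _ = _ := by ring
  · obtain ⟨m, hm⟩ : ∃ m, m = (n + 1) / 4 := ⟨_, rfl⟩
    have hm1 : 1 ≤ m := by omega
    have hm0 : (0 : ℝ) < m := by exact_mod_cast hm1
    have h1 := h.sq_norm_sub_le hm1 (N := 2 * m) (ih (2 * m) (by omega) (by omega)) (hd m hm1)
      (n := n) (by omega) y
    refine (sq_le_sq₀ (norm_nonneg _) (by positivity)).1 (h1.trans ?_)
    have hn6 : (n : ℝ) ≤ 6 * m := by exact_mod_cast (by omega : n ≤ 6 * m)
    -- The slack `16 / 9` is `64 / 6 ^ 2`: it is what `n ≤ 6 * m`, sharp at `n = 6`, leaves over.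
    have key : (16 / 9 : ℝ) ^ α * (((2 * m : ℕ) : ℝ) ^ (-α) * (m : ℝ) ^ (-α)) ≤
        32 ^ α * ((n : ℝ) ^ (-α)) ^ 2 := by
      rw [Real.rpow_neg hn0.le, Real.rpow_neg hm0.le, Real.rpow_neg (Nat.cast_nonneg _),
        ← Real.inv_rpow hn0.le, ← Real.inv_rpow hm0.le, ← Real.inv_rpow (Nat.cast_nonneg _),
        sq, ← Real.mul_rpow (by positivity) (by positivity),
        ← Real.mul_rpow (by positivity) (by positivity),
        ← Real.mul_rpow (by positivity) (by positivity),
        ← Real.mul_rpow (by positivity) (by positivity)]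
      refine Real.rpow_le_rpow (by positivity) ?_ hα.le
      push_cast
      rw [← mul_inv, ← mul_inv, ← div_eq_mul_inv, ← div_eq_mul_inv,
        div_le_div_iff₀ (by positivity) (by positivity)]
      nlinarith
    rw [div_eq_mul_inv]
    calc 2 * (2 * 32 ^ α * C * ((2 * m : ℕ) : ℝ) ^ (-α)) * (C * (m : ℝ) ^ (-α)) * G⁻¹
        ≤ 2 * (2 * 32 ^ α * C * ((2 * m : ℕ) : ℝ) ^ (-α)) * (C * (m : ℝ) ^ (-α)) *
          (16 / 9 : ℝ) ^ α := by gcongr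
      _ = 4 * 32 ^ α * C ^ 2 *
          ((16 / 9 : ℝ) ^ α * (((2 * m : ℕ) : ℝ) ^ (-α) * (m : ℝ) ^ (-α))) := by ring
      _ ≤ 4 * 32 ^ α * C ^ 2 * (32 ^ α * ((n : ℝ) ^ (-α)) ^ 2) := by gcongr
      _ = _ := by ring

/-- A greedy selection inherits an exponential decay of the widths. -/
theorem exponential_rate (h : IsGreedyChain w V x g G) {α C₁ C₂ : ℝ} (hα : 0 < α) (hC₁ : 0 ≤ C₁)
    (hC₂ : 0 ≤ C₂) (hw : ∀ y, ‖w y‖ ≤ 1)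
    (hG : G⁻¹ ≤ Real.exp (C₂ * ((2⁻¹ : ℝ) ^ α - (4⁻¹ : ℝ) ^ α)))
    (hd : ∀ m : ℕ, 1 ≤ m → HasWidthLE w m (C₁ * Real.exp (-C₂ * (m : ℝ) ^ α)))
    (n : ℕ) (hn : 1 ≤ n) (y : S) :
    ‖w y - (V n).starProjection (w y)‖ ≤
      √(2 * C₁) * Real.exp (-((2 : ℝ) ^ (-1 - 2 * α) * C₂) * (n : ℝ) ^ α) := by
  have hc : (2 : ℝ) ^ (-1 - 2 * α) = 2⁻¹ * (4⁻¹ : ℝ) ^ α := by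
    rw [sub_eq_add_neg, Real.rpow_add two_pos, Real.rpow_neg_one, Real.inv_rpow (by norm_num),
      ← Real.rpow_neg (by norm_num), show (4 : ℝ) = 2 ^ (2 : ℝ) by norm_num,
      ← Real.rpow_mul two_pos.le]
    congr 2
    ring
  -- The largest `m` with `2 * m ≤ n + 1`, so `m ≥ n / 2`. After squaring, the exponent available
  -- has `2⁻¹ ^ α` and the target only `4⁻¹ ^ α`; the difference pays for `G⁻¹`, since `n ^ α ≥ 1`.
  obtain ⟨m, hm⟩ : ∃ m, m = (n + 1) / 2 := ⟨_, rfl⟩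
  have hm1 : 1 ≤ m := by omega
  have hs : ∀ z, ‖w z - (V 0).starProjection (w z)‖ ≤ 1 := fun z => by
    have := norm_sub_starProjection_le_norm_sub (V 0) (w z) (zero_mem _)
    rw [sub_zero] at this
    exact this.trans (hw z)
  have h1 := h.sq_norm_sub_le hm1 (N := 0) hs (hd m hm1) (n := n) (by omega) y
  refine (sq_le_sq₀ (norm_nonneg _) (by positivity)).1 (h1.trans ?_)
  rw [mul_pow, Real.sq_sqrt (by positivity), ← Real.exp_nat_mul, hc, div_eq_mul_inv]
  have hn1 : (1 : ℝ) ≤ (n : ℝ) ^ α := Real.one_le_rpow (by exact_mod_cast hn) hα.le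
  have hmn : (2⁻¹ : ℝ) ^ α * (n : ℝ) ^ α ≤ (m : ℝ) ^ α := by
    rw [← Real.mul_rpow (by norm_num) (Nat.cast_nonneg _)]
    refine Real.rpow_le_rpow (by positivity) ?_ hα.le
    have : (n : ℝ) ≤ 2 * m := by exact_mod_cast (by omega : n ≤ 2 * m)
    linarith
  have h42 : (4⁻¹ : ℝ) ^ α ≤ (2⁻¹ : ℝ) ^ α :=
    Real.rpow_le_rpow (by norm_num) (by norm_num) hα.le
  calc 2 * 1 * (C₁ * Real.exp (-C₂ * (m : ℝ) ^ α)) * G⁻¹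
      ≤ 2 * 1 * (C₁ * Real.exp (-C₂ * (m : ℝ) ^ α)) *
        Real.exp (C₂ * ((2⁻¹ : ℝ) ^ α - (4⁻¹ : ℝ) ^ α)) := by gcongr
    _ = 2 * C₁ * Real.exp (-C₂ * (m : ℝ) ^ α + C₂ * ((2⁻¹ : ℝ) ^ α - (4⁻¹ : ℝ) ^ α)) := by
        rw [Real.exp_add]; ring
    _ ≤ _ := by
        gcongr
        have h2 : (2⁻¹ : ℝ) ^ α - (4⁻¹ : ℝ) ^ α ≤ ((2⁻¹ : ℝ) ^ α - (4⁻¹ : ℝ) ^ α) * (n : ℝ) ^ α :=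
          le_mul_of_one_le_right (sub_nonneg.2 h42) hn1
        have h3 := mul_le_mul_of_nonneg_left (h2.trans (sub_mul _ _ _).le) hC₂
        have h4 := mul_le_mul_of_nonneg_left hmn hC₂
        push_cast
        linarith

end IsGreedyChain

end Greedy

/-! ### Kernel sections and the power function. -/

section Sections

variable {S : Type*} {H : Type*} [NormedAddCommGroup H] [InnerProductSpace ℝ H] [CompleteSpace H]
  [RKHS ℝ H S ℝ]

lemma inner_kernelSection (f : H) (x : S) : inner ℝ f (kernelSection H x) = f x := by
  simp [kernelSection]

lemma IsRKHSOf.inner_kernelSection_kernelSection {k : S → S → ℝ} (hH : IsRKHSOf H k) (x y : S) :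
    inner ℝ (kernelSection H x) (kernelSection H y) = k y x := by
  obtain ⟨g, hg, hgf⟩ := hH x
  have : kernelSection H x = g :=
    ext_inner_left ℝ fun f => by rw [inner_kernelSection, hgf]
  rw [inner_kernelSection, this, hg]

/-- The quadratic form of the kernel matrix at `g` is the squared norm of the combination with
coefficients `g`. -/
lemma IsRKHSOf.linearIndependent_kernelSection {k : S → S → ℝ} (hk : IsStrictlyPosDefKernel k)
    (hH : IsRKHSOf H k) : LinearIndependent ℝ (kernelSection H : S → H) := by
  rw [linearIndependent_iff']
  intro s g hg i hi
  by_contra hgi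
  have hpos := (hk s).dotProduct_mulVec_pos (x := fun i => g i)
    (fun h => hgi (congrFun h ⟨i, hi⟩))
  have h0 : inner ℝ (∑ i ∈ s, g i • kernelSection H i) (∑ i ∈ s, g i • kernelSection H i) = 0 := by
    rw [hg, inner_zero_left]
  refine hpos.ne' ?_
  rw [← h0]
  simp only [sum_inner, inner_sum, real_inner_smul_left, real_inner_smul_right,
    hH.inner_kernelSection_kernelSection, dotProduct, Matrix.mulVec, Matrix.of_apply, star_trivial,
    Finset.mul_sum]
  rw [← Finset.sum_coe_sort s]
  refine Finset.sum_congr rfl fun a _ => ?_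
  rw [← Finset.sum_coe_sort s]
  exact Finset.sum_congr rfl fun b _ => by ring

/-- Pointwise error bounds are bounds on the power function. -/
lemma hasInterpolationRate_iff (X : ℕ → Finset S) (r : ℕ → ℝ) :
    HasInterpolationRate H X r ↔
      ∀ n, 1 ≤ n → ∀ x, powerFunction H (X n) x ≤ max (r n) 0 := by
  have herr : ∀ n (f : H) x, f x - interpolant (X n) f x =
      inner ℝ f (kernelSection H x - interpolant (X n) (kernelSection H x)) := fun n f x => by
    rw [← inner_kernelSection, ← inner_kernelSection, inner_sub_right]
    congr 1
    exact Submodule.inner_starProjection_left_eq_right _ _ _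
  refine forall₂_congr fun n _ => ⟨fun h x => ?_, fun h f => ?_⟩
  -- The extremal function is `u` itself: its error at `x` is `‖u‖ ^ 2`.
  · set u := kernelSection H x - interpolant (X n) (kernelSection H x) with hu
    have h1 := (le_iSup (fun x => ‖u x - interpolant (X n) u x‖ₑ) x).trans (h u)
    rw [herr, ← hu, real_inner_self_eq_norm_sq, Real.enorm_eq_ofReal (sq_nonneg _)] at h1
    change ‖u‖ ≤ _
    -- If `u = 0`, a negative `r n` is not excluded, because `ENNReal.ofReal` truncates; hence the
    -- `max` with `0`.
    rcases (norm_nonneg u).eq_or_lt with h0 | h0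
    · rw [← h0]; exact le_max_right _ _
    · by_contra hlt
      rw [not_le, max_lt_iff] at hlt
      have h2 : r n * ‖u‖ < ‖u‖ ^ 2 := by
        rw [sq]; exact mul_lt_mul_of_pos_right hlt.1 h0
      exact absurd h1 (not_le.2 ((ENNReal.ofReal_lt_ofReal_iff (by positivity)).2 h2))
  · refine iSup_le fun x => ?_
    rw [← ofReal_norm]
    beta_reduce
    rw [herr]
    refine (ENNReal.ofReal_le_ofReal ((norm_inner_le_norm _ _).trans
      (mul_le_mul_of_nonneg_left (h x) (norm_nonneg f)))).trans ?_
    rw [mul_comm, max_mul_of_nonneg _ _ (norm_nonneg f), zero_mul]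
    rcases le_total (r n * ‖f‖) 0 with h0 | h0
    · simp [max_eq_right h0]
    · rw [max_eq_left h0]

end Sections

/-! ### Distances determined by Gram matrices. -/

section SpanImage

variable {S E E' : Type*} [NormedAddCommGroup E] [InnerProductSpace ℝ E]
  [NormedAddCommGroup E'] [InnerProductSpace ℝ E']

/-- The span of the vectors `w y` with `y` in a finite set. -/
noncomputable def spanImage (w : S → E) (Y : Finset S) : Submodule ℝ E := Submodule.span ℝ (w '' (Y : Set S))

instance finiteDimensional_spanImage (w : S → E) (Y : Finset S) :
    FiniteDimensional ℝ (spanImage w Y) :=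
  FiniteDimensional.span_of_finite ℝ (Y.finite_toSet.image _)

lemma norm_linearCombination_eq {w : S → E} {w' : S → E'}
    (h : ∀ x y, inner ℝ (w x) (w y) = inner ℝ (w' x) (w' y)) (c : S →₀ ℝ) :
    ‖Finsupp.linearCombination ℝ w c‖ = ‖Finsupp.linearCombination ℝ w' c‖ := by
  rw [← sq_eq_sq₀ (norm_nonneg _) (norm_nonneg _), ← real_inner_self_eq_norm_sq,
    ← real_inner_self_eq_norm_sq]
  simp only [Finsupp.linearCombination_apply, Finsupp.sum, sum_inner, inner_sum,
    real_inner_smul_left, real_inner_smul_right, h]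

/-- The coefficients of the best approximation for `w'` give a competitor for `w` with the same
error norm. -/
lemma norm_sub_spanImage_le {w : S → E} {w' : S → E'}
    (h : ∀ x y, inner ℝ (w x) (w y) = inner ℝ (w' x) (w' y)) (Y : Finset S) (y : S) :
    ‖w y - (spanImage w Y).starProjection (w y)‖ ≤
      ‖w' y - (spanImage w' Y).starProjection (w' y)‖ := by
  obtain ⟨c, hc, hcy⟩ := (Finsupp.mem_span_image_iff_linearCombination ℝ).1
    (Submodule.starProjection_apply_mem (spanImage w' Y) (w' y))
  have h1 : Finsupp.linearCombination ℝ w c ∈ spanImage w Y :=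
    (Finsupp.mem_span_image_iff_linearCombination ℝ).2 ⟨c, hc, rfl⟩
  refine (norm_sub_starProjection_le_norm_sub _ _ h1).trans_eq ?_
  rw [← hcy]
  have h2 := norm_linearCombination_eq h (Finsupp.single y 1 - c)
  simpa only [map_sub, Finsupp.linearCombination_single, one_smul] using h2

/-- The distances of the `w y` to spans of such vectors depend on their Gram matrix only. -/
lemma norm_sub_spanImage_eq {w : S → E} {w' : S → E'}
    (h : ∀ x y, inner ℝ (w x) (w y) = inner ℝ (w' x) (w' y)) (Y : Finset S) (y : S) :
    ‖w y - (spanImage w Y).starProjection (w y)‖ =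
      ‖w' y - (spanImage w' Y).starProjection (w' y)‖ :=
  le_antisymm (norm_sub_spanImage_le h Y y) 
    (norm_sub_spanImage_le (w := w') (w' := w) (fun x y => (h x y).symm) Y y)

lemma norm_sub_spanImage_pos {w : S → E} (hw : LinearIndependent ℝ w) {Y : Finset S} {y : S}
    (hy : y ∉ Y) : 0 < ‖w y - (spanImage w Y).starProjection (w y)‖ := by
  rw [norm_sub_pos_iff]
  intro h
  refine hw.notMem_span_image (s := (Y : Set S)) hy ?_
  have := Submodule.starProjection_apply_mem (spanImage w Y) (w y)
  rwa [← h] at this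

lemma norm_sub_spanImage_of_mem {w : S → E} {Y : Finset S} {y : S} (hy : y ∈ Y) :
    ‖w y - (spanImage w Y).starProjection (w y)‖ = 0 := by
  have h := norm_sub_starProjection_le_norm_sub (spanImage w Y) (w y)
    (Submodule.subset_span (Set.mem_image_of_mem w hy) : w y ∈ spanImage w Y)
  rw [sub_self, norm_zero] at h
  exact le_antisymm h (norm_nonneg _)

end SpanImage

/-! ### Existence and cardinality of greedy sets. -/

section GreedySets

variable {S : Type*} {E : Type*} [NormedAddCommGroup E] [InnerProductSpace ℝ E]

/-- A weak greedy selection for a function `P` of a finite set and a point, with a factor that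
may depend on the step. -/
def IsGreedyFor (P : Finset S → S → ℝ) (g : ℕ → ℝ) (Y : ℕ → Finset S) : Prop :=
  Y 0 = ∅ ∧ ∀ n, ∃ x : S, (∀ y, g n * P (Y n) y ≤ P (Y n) x) ∧
    (Y (n + 1) : Set S) = insert x (Y n : Set S)

namespace IsGreedyFor

variable {P : Finset S → S → ℝ} {g : ℕ → ℝ} {Y : ℕ → Finset S}

lemma monotone (h : IsGreedyFor P g Y) : Monotone Y :=
  monotone_nat_of_le_succ fun n => by
    obtain ⟨x, -, hx⟩ := h.2 n
    rw [← Finset.coe_subset, hx]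
    exact Set.subset_insert _ _

lemma isNestedPointSequence (h : IsGreedyFor P g Y) (hg : ∀ n, 0 < g n)
    (h0 : ∀ Y, ∀ y ∈ Y, P Y y = 0) (hP : ∀ Y, ∀ y ∉ Y, 0 < P Y y) : IsNestedPointSequence Y := by
  classical
  refine ⟨h.monotone, fun n => ?_⟩
  have key : (Y n).card ≤ n ∧ ((Y n : Set S) = Set.univ ∨ (Y n).card = n) := by
    induction n with
    | zero => simp [h.1]
    | succ n ih =>
      obtain ⟨x, hx, hxY⟩ := h.2 n
      have hY : Y (n + 1) = insert x (Y n) := by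
        rw [← Finset.coe_inj, hxY, Finset.coe_insert]
      refine ⟨by rw [hY]; exact (Finset.card_insert_le _ _).trans (by omega), ?_⟩
      by_cases hu : (Y n : Set S) = Set.univ
      · left
        rw [hxY, hu, Set.insert_eq_of_mem (Set.mem_univ x)]
      · right
        obtain ⟨y, hy⟩ := (Set.ne_univ_iff_exists_notMem _).1 hu
        -- While points remain, some value of `P` is positive, so the selected one is too, and its
        -- point is new.
        have hxn : x ∉ Y n := fun hxn => by
          have h1 := hx y
          rw [h0 _ _ hxn] at h1
          exact absurd h1 (not_le.2 (mul_pos (hg n) (hP _ _ hy)))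
        rw [hY, Finset.card_insert_of_notMem hxn, ih.2.resolve_left hu]
  have hle : ((Y n).card : ℕ∞) ≤ ENat.card S := by
    rw [← Set.encard_univ, ← Set.encard_coe_eq_coe_finsetCard]
    exact Set.encard_le_encard (Set.subset_univ _)
  refine le_antisymm (le_min (by exact_mod_cast key.1) hle) ?_
  rcases key.2 with h1 | h1
  · rw [← Set.encard_univ, ← h1, Set.encard_coe_eq_coe_finsetCard]
    exact min_le_right _ _
  · rw [h1]; exact min_le_left _ _

lemma exists_isGreedyChain {w : S → E}
    (h : IsGreedyFor (fun Y y => ‖w y - (spanImage w Y).starProjection (w y)‖) g Y) {G : ℝ}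
    (hg : ∀ n, 0 ≤ g n) (hg1 : ∀ n, g n ≤ 1) (hG : 0 < G)
    (hgG : ∀ n, G ≤ ∏ i ∈ Finset.range n, g i) :
    ∃ x, IsGreedyChain w (fun n => spanImage w (Y n)) x g G := by
  choose x hx hxY using h.2
  refine ⟨x, fun a b hab => ?_, fun n => ?_, hg, hg1, hx, hG, hgG⟩
  · exact Submodule.span_mono (Set.image_mono (Finset.coe_subset.2 (h.monotone hab)))
  · refine Submodule.subset_span (Set.mem_image_of_mem w ?_)
    rw [hxY]
    exact Set.mem_insert _ _

end IsGreedyFor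

/-- A factor below `1` puts the target strictly under a positive supremum, so no maximizer is
needed. -/
lemma exists_isGreedyFor [Nonempty S] (P : Finset S → S → ℝ) (hP : ∀ Y y, 0 ≤ P Y y)
    (hP1 : ∀ Y y, P Y y ≤ 1) (g : ℕ → ℝ) (hg : ∀ n, 0 ≤ g n) (hg1 : ∀ n, g n < 1) :
    ∃ Y, IsGreedyFor P g Y := by
  classical
  have hstep : ∀ n Y, ∃ x, ∀ y, g n * P Y y ≤ P Y x := fun n Y => by
    have hb : BddAbove (Set.range (P Y)) := ⟨1, by rintro _ ⟨y, rfl⟩; exact hP1 Y y⟩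
    have hle := le_ciSup hb
    rcases (Real.iSup_nonneg (hP Y)).eq_or_lt with h0 | h0
    · refine ⟨Classical.arbitrary S, fun y => ?_⟩
      have : P Y y = 0 := le_antisymm ((hle y).trans h0.ge) (hP Y y)
      rw [this, mul_zero]
      exact hP _ _
    · obtain ⟨x, hx⟩ := exists_lt_of_lt_ciSup (mul_lt_of_lt_one_left h0 (hg1 n))
      exact ⟨x, fun y => (mul_le_mul_of_nonneg_left (hle y) (hg n)).trans hx.le⟩
  choose x hx using hstep
  let Y : ℕ → Finset S := fun n => Nat.rec ∅ (fun n Z => insert (x n Z) Z) n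
  exact ⟨Y, rfl, fun n => ⟨x n (Y n), hx n (Y n), Finset.coe_insert _ _⟩⟩

/-- Factors below `1`, all at least `G`, whose products stay above `G`. -/
lemma exists_factors {G : ℝ} (hG : 0 < G) (hG1 : G < 1) :
    ∃ g : ℕ → ℝ, (∀ n, G ≤ g n) ∧ (∀ n, g n < 1) ∧ ∀ n, G ≤ ∏ i ∈ Finset.range n, g i := by
  -- The exponents `2^-(i+1)` sum to less than `1`.
  have hprod : ∀ n, ∏ i ∈ Finset.range n, G ^ ((1 / 2 : ℝ) ^ (i + 1)) =
      G ^ (1 - (1 / 2 : ℝ) ^ n) := fun n => by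
    induction n with
    | zero => simp
    | succ n ih =>
      rw [Finset.prod_range_succ, ih, ← Real.rpow_add hG]
      congr 1
      ring
  have hle : ∀ t : ℝ, t ≤ 1 → G ≤ G ^ t := fun t ht => by
    simpa using Real.rpow_le_rpow_of_exponent_ge hG hG1.le ht
  refine ⟨fun n => G ^ ((1 / 2 : ℝ) ^ (n + 1)), fun n => ?_, fun n => ?_, fun n => ?_⟩
  · exact hle _ (pow_le_one₀ (by norm_num) (by norm_num))
  · exact Real.rpow_lt_one hG.le hG1 (by positivity)
  · rw [hprod]
    exact hle _ (by simp)

lemma exists_factor_of_one_lt {γ B : ℝ} (hγ : γ < 1) (hB : 1 < B) :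
    ∃ G : ℝ, 0 < G ∧ G < 1 ∧ γ ≤ G ∧ G⁻¹ ≤ B := by
  have hB0 : 0 < B := one_pos.trans hB
  refine ⟨max γ B⁻¹, lt_max_of_lt_right (inv_pos.2 hB0), max_lt hγ (inv_lt_one_of_one_lt₀ hB),
    le_max_left _ _, ?_⟩
  exact inv_le_of_inv_le₀ hB0 (le_max_right _ _)

end GreedySets

/-! ### Transfer from `Ω` to `Ω'`. -/

section Restriction

variable {E : Type*} {Ω' Ω : Set E} (hsub : Ω' ⊆ Ω) {k : Ω → Ω → ℝ}
  {H : Type*} [NormedAddCommGroup H] [InnerProductSpace ℝ H] [CompleteSpace H] [RKHS ℝ H Ω ℝ]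
  {H' : Type*} [NormedAddCommGroup H'] [InnerProductSpace ℝ H'] [CompleteSpace H']
  [RKHS ℝ H' Ω' ℝ]

lemma powerFunction_restrict (hH : IsRKHSOf H k) (hH' : IsRKHSOf H' (restrictKernel hsub k))
    (Y : Finset Ω') (y : Ω') :
    powerFunction H' Y y = ‖kernelSection H (Set.inclusion hsub y) -
      (spanImage (fun y => kernelSection H (Set.inclusion hsub y)) Y).starProjection
        (kernelSection H (Set.inclusion hsub y))‖ :=
  norm_sub_spanImage_eq (w := kernelSection H')
    (w' := fun y => kernelSection H (Set.inclusion hsub y)) (fun a b => by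
      rw [hH.inner_kernelSection_kernelSection, hH'.inner_kernelSection_kernelSection]; rfl) Y y

lemma hasWidthLE_of_hasInterpolationRate {X : ℕ → Finset Ω} (hX : ∀ n, (X n).card ≤ n) {r : ℕ → ℝ}
    (h : HasInterpolationRate H X r) (n : ℕ) (hn : 1 ≤ n) :
    HasWidthLE (fun y => kernelSection H (Set.inclusion hsub y)) n (max (r n) 0) := by
  classical
  refine ⟨kernelSpan H (X n), inferInstance, ?_, fun y => ?_⟩
  · rw [kernelSpan, ← Finset.coe_image]
    exact (finrank_span_finset_le_card _).trans (Finset.card_image_le.trans (hX n))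
  · exact (hasInterpolationRate_iff X r).1 h n hn (Set.inclusion hsub y)

/-- Rates that hold for every chain of greedy subspaces with factor products above `G`, with `G`
close enough to `1`, hold for `P`-greedy sequences and for suitable weak `P`-greedy ones. -/
lemma greedy_rates (hne : Ω'.Nonempty) (hk : IsStrictlyPosDefKernel k) (hk1 : ∀ x, k x x ≤ 1)
    (hH : IsRKHSOf H k) (hH' : IsRKHSOf H' (restrictKernel hsub k)) {B : ℝ} (hB : 1 < B)
    {r : ℕ → ℝ}
    (hr : ∀ (V : ℕ → Submodule ℝ H) [∀ n, FiniteDimensional ℝ (V n)] (x : ℕ → Ω') (g : ℕ → ℝ)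
      (G : ℝ), G⁻¹ ≤ B →
      IsGreedyChain (fun y : Ω' => kernelSection H (Set.inclusion hsub y)) V x g G →
      ∀ n, 1 ≤ n → ∀ y : Ω', ‖kernelSection H (Set.inclusion hsub y) -
        (V n).starProjection (kernelSection H (Set.inclusion hsub y))‖ ≤ max (r n) 0) :
    (∀ Y : ℕ → Finset Ω', IsPGreedy H' Y → IsNestedPointSequence Y ∧ HasInterpolationRate H' Y r) ∧
    (∀ γ : ℝ, 0 < γ → γ < 1 → ∃ Y : ℕ → Finset Ω', IsWeakPGreedy H' γ Y ∧
      IsNestedPointSequence Y ∧ HasInterpolationRate H' Y r) := by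
  set w : Ω' → H := fun y => kernelSection H (Set.inclusion hsub y) with hw
  have hP : powerFunction H' = fun Y y => ‖w y - (spanImage w Y).starProjection (w y)‖ := by
    ext Y y
    exact powerFunction_restrict hsub hH hH' Y y
  have hli : LinearIndependent ℝ w :=
    (hH.linearIndependent_kernelSection hk).comp _ (Set.inclusion_injective hsub)
  have key : ∀ (Y : ℕ → Finset Ω') (g : ℕ → ℝ) (G : ℝ), (∀ n, 0 < g n) → (∀ n, g n ≤ 1) → 0 < G →
      (∀ n, G ≤ ∏ i ∈ Finset.range n, g i) → G⁻¹ ≤ B → IsGreedyFor (powerFunction H') g Y →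
      IsNestedPointSequence Y ∧ HasInterpolationRate H' Y r := by
    intro Y g G hg hg1 hG hgG hGB hY
    rw [hP] at hY
    refine ⟨hY.isNestedPointSequence hg (fun _ _ => norm_sub_spanImage_of_mem)
      (fun _ _ => norm_sub_spanImage_pos hli), ?_⟩
    obtain ⟨x, hx⟩ := hY.exists_isGreedyChain (fun n => (hg n).le) hg1 hG hgG
    rw [hasInterpolationRate_iff, hP]
    exact hr _ x g G hGB hx
  refine ⟨fun Y hY => ?_, fun γ hγ hγ1 => ?_⟩
  · refine key Y (fun _ => 1) 1 (by simp) (by simp) one_pos (by simp) (by simpa using hB.le) ?_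
    simpa [IsGreedyFor, IsPGreedy] using hY
  -- `γ ≤ G ≤ g n` makes the selection `γ`-weak, while `G⁻¹ ≤ B` keeps the loss within the slack.
  · obtain ⟨G, hG, hG1, hγG, hGB⟩ := exists_factor_of_one_lt hγ1 hB
    obtain ⟨g, hg, hg1, hgG⟩ := exists_factors hG hG1
    have : Nonempty Ω' := hne.to_subtype
    have hw1 : ∀ y, ‖w y‖ ≤ 1 := fun y => by
      rw [← sq_le_one_iff₀ (norm_nonneg _), ← real_inner_self_eq_norm_sq]
      simp only [hw, hH.inner_kernelSection_kernelSection]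
      exact hk1 _
    obtain ⟨Y, hY⟩ := exists_isGreedyFor (powerFunction H') (fun _ _ => norm_nonneg _)
      (fun Z y => by
        rw [hP]
        have := norm_sub_starProjection_le_norm_sub (spanImage w Z) (w y) (zero_mem _)
        rw [sub_zero] at this
        exact this.trans (hw1 y)) g (fun n => hG.le.trans (hg n)) hg1
    refine ⟨Y, ⟨hY.1, fun n => ?_⟩,
      key Y g G (fun n => hG.trans_le (hg n)) (fun n => (hg1 n).le) hG hgG hGB hY⟩
    obtain ⟨x, hx, hxY⟩ := hY.2 n
    exact ⟨x, fun y => (mul_le_mul_of_nonneg_right (hγG.trans (hg n)) (norm_nonneg _)).trans (hx y),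
      hxY⟩

end Restriction

/-! ### The two decay rates. -/

theorem mainTheorem1 {d : ℕ} {Ω' Ω : Set (EuclideanSpace ℝ (Fin d))}
    (hne : Ω'.Nonempty) (hsub : Ω' ⊆ Ω)
    (k : Ω → Ω → ℝ) (hk : IsStrictlyPosDefKernel k) (hk1 : ∀ x, k x x ≤ 1)
    {H : Type*} [NormedAddCommGroup H] [InnerProductSpace ℝ H] [CompleteSpace H]
    [RKHS ℝ H Ω ℝ] (hH : IsRKHSOf H k)
    {H' : Type*} [NormedAddCommGroup H'] [InnerProductSpace ℝ H'] [CompleteSpace H']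
    [RKHS ℝ H' Ω' ℝ] (hH' : IsRKHSOf H' (restrictKernel hsub k))
    (X : ℕ → Finset Ω) (hX : ∀ n, (X n).card ≤ n) (α : ℝ) (hα : 0 < α) :
    (∀ C₀ : ℝ, HasInterpolationRate H X (fun n => C₀ * (n : ℝ) ^ (-α)) →
      (∀ Y : ℕ → Finset Ω', IsPGreedy H' Y →
        IsNestedPointSequence Y ∧
        HasInterpolationRate H' Y
          (fun n => (2 : ℝ) ^ (5 * α + 1) * C₀ * (n : ℝ) ^ (-α))) ∧
      (∀ γ : ℝ, 0 < γ → γ < 1 → ∃ Y : ℕ → Finset Ω', IsWeakPGreedy H' γ Y ∧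
        IsNestedPointSequence Y ∧
        HasInterpolationRate H' Y
          (fun n => (2 : ℝ) ^ (5 * α + 1) * C₀ * (n : ℝ) ^ (-α)))) ∧
    (∀ C₁ C₂ : ℝ, 0 < C₂ →
      HasInterpolationRate H X (fun n => C₁ * Real.exp (-C₂ * (n : ℝ) ^ α)) →
      (2 : ℝ) ^ (-1 - 2 * α) * C₂ < C₂ ∧
      (∀ Y : ℕ → Finset Ω', IsPGreedy H' Y →
        IsNestedPointSequence Y ∧
        HasInterpolationRate H' Y
          (fun n => √(2 * C₁) *
            Real.exp (-((2 : ℝ) ^ (-1 - 2 * α) * C₂) * (n : ℝ) ^ α))) ∧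
      (∀ γ : ℝ, 0 < γ → γ < 1 → ∃ Y : ℕ → Finset Ω', IsWeakPGreedy H' γ Y ∧
        IsNestedPointSequence Y ∧
        HasInterpolationRate H' Y
          (fun n => √(2 * C₁) *
            Real.exp (-((2 : ℝ) ^ (-1 - 2 * α) * C₂) * (n : ℝ) ^ α)))) := by
  refine ⟨fun C₀ hC₀ => ?_, fun C₁ C₂ hC₂ hC₁ => ⟨?_, ?_⟩⟩
  · refine greedy_rates hsub hne hk hk1 hH hH' (Real.one_lt_rpow (x := 16 / 9) (by norm_num) hα) ?_
    intro V _ x g G hG h n hn y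
    -- No sign is assumed for `C₀`, hence its positive part.
    have hd : ∀ m : ℕ, 1 ≤ m → HasWidthLE (fun y : Ω' => kernelSection H (Set.inclusion hsub y)) m
        (max C₀ 0 * (m : ℝ) ^ (-α)) := fun m hm => by
      have := hasWidthLE_of_hasInterpolationRate hsub hX hC₀ m hm
      rwa [max_mul_of_nonneg _ _ (by positivity), zero_mul]
    have := h.algebraic_rate hα (le_max_right _ _) hG hd n hn y
    rwa [mul_max_of_nonneg _ _ (by positivity), max_mul_of_nonneg _ _ (by positivity), mul_zero,
      zero_mul] at this
  · refine mul_lt_of_lt_one_left hC₂ (Real.rpow_lt_one_of_one_lt_of_neg one_lt_two ?_)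
    linarith
  · have h42 : (4⁻¹ : ℝ) ^ α < (2⁻¹ : ℝ) ^ α :=
      Real.rpow_lt_rpow (by norm_num) (by norm_num) hα
    refine greedy_rates hsub hne hk hk1 hH hH'
      (Real.one_lt_exp_iff.2 (mul_pos hC₂ (sub_pos.2 h42))) ?_
    intro V _ x g G hG h n hn y
    have hd : ∀ m : ℕ, 1 ≤ m → HasWidthLE (fun y : Ω' => kernelSection H (Set.inclusion hsub y)) m
        (max C₁ 0 * Real.exp (-C₂ * (m : ℝ) ^ α)) := fun m hm => by
      have := hasWidthLE_of_hasInterpolationRate hsub hX hC₁ m hm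
      rwa [max_mul_of_nonneg _ _ (by positivity), zero_mul]
    have hw : ∀ y : Ω', ‖kernelSection H (Set.inclusion hsub y)‖ ≤ 1 := fun y => by
      rw [← sq_le_one_iff₀ (norm_nonneg _), ← real_inner_self_eq_norm_sq,
        hH.inner_kernelSection_kernelSection]
      exact hk1 _
    have h1 := h.exponential_rate hα (le_max_right _ _) hC₂.le hw hG hd n hn y
    have h2 : √(2 * max C₁ 0) = √(2 * C₁) := by
      rcases le_total C₁ 0 with h0 | h0
      · rw [max_eq_right h0, mul_zero, Real.sqrt_zero, Real.sqrt_eq_zero_of_nonpos (by linarith)]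
      · rw [max_eq_left h0]
    rw [h2] at h1
    exact h1.trans (le_max_left _ _)
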